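/- A probabilistic pushdown automaton (pPDA) $\Delta=(Q,\Gamma,\delta)$ consists of a finite set $Q$ of states, a finite stack alphabet $\Gamma$, and a finite set $\delta$ of transitions $pZ \xrightarrow{a} q\alpha$ with $p,q\in Q$, $Z\in\Gamma$, rational weight $a\ge 0$ and $\alpha\in\Gamma^*$, $|\alpha|\le 2$, such that for every $pZ\in Q\times\Gamma$ the weights of the transitions leaving $pZ$ sum to $1$. It induces a transition system on the configurations $Q\times\Gamma^*$: from $pZ\beta$ it moves to $q\alpha\beta$ with the total weight of the transitions from $pZ$ to $q\alpha$; configurations $q\varepsilon$ with empty stack have no successors. Write $\mathit{ert}(pZ)\in[0,\infty]$ for the expected number of steps from $pZ$ until the stack is empty ($\infty$ if the stack is emptied with probability less than $1$), $[pZq]$ for the sum of the probabilities of all finite paths from $pZ$ to $q\varepsilon$ (the return probability), and $\mathsf E[pZq]$ for the sum, over the same paths, of probability times length (number of steps). The automaton is positively almost-surely terminating (PAST) if from every configuration the expected number of steps until the stack is empty is finite. The encoding size of $\Delta$ is $|Q|+|\Gamma|$ plus the length of the list of all its transitions, where every occurrence of a state or of a stack symbol has length one and the weights are written as pairs of integers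 in binary. **Theorem.** There exist a family $\{\Delta_n \mid n\ge 1\}$ of PAST pPDA with distinguished initial configurations $pY$ (a state $p$ and a stack symbol $Y$ of $\Delta_n$) and a constant $c>0$ such that for every $n\ge 1$: $$\mathit{ert}(pY) \;=\; \mathsf E[pYp] \;\ge\; 2^{2^n},$$ and the minimal non-zero return probability $\min\{[qZt] \mid q,t\in Q,\ Z\in\Gamma,\ [qZt]>0\}$ of $\Delta_n$ is at least $c$. Moreover, the encoding size of $\Delta_n$ is linear in $n$ (bounded above and below by positive constant multiples of $n$). -/

import Mathlib

open scoped ENNReal NNReal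

noncomputable section

/-! ### Weighted transition systems with a set of target states -/

section Systems

variable {S : Type}

/-- The matrix `M` with all rows indexed by the target set `F` replaced by zero rows. -/
def killRows (M : S → S → ℝ≥0∞) (F : Set S) (s t : S) : ℝ≥0∞ :=
  open Classical in if s ∈ F then 0 else M s t

/-- The product of the (possibly infinite) nonnegative matrix `A` and the column vector `v`. -/
def matVec (A : S → S → ℝ≥0∞) (v : S → ℝ≥0∞) (s : S) : ℝ≥0∞ :=
  ∑' t, A s t * v t

/-- The vector `1 - χ(F)`. -/
def offTarget (F : Set S) (s : S) : ℝ≥0∞ :=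
  open Classical in if s ∈ F then 0 else 1

/-- The expected runtime `∑ₖ (M_F ^ k (1 - χ(F))) s` until `F` is reached from `s`. -/
def expectedRuntime (M : S → S → ℝ≥0∞) (F : Set S) (s : S) : ℝ≥0∞ :=
  ∑' k : ℕ, ((matVec (killRows M F))^[k] (offTarget F)) s

/-- The weight of a path, given as the list of the states it visits: the product of the weights of
its steps. -/
def pathWeight (M : S → S → ℝ≥0∞) : List S → ℝ≥0∞
  | [] => 1
  | [_] => 1
  | s :: t :: π => M s t * pathWeight M (t :: π)

/-- `π` is a nonempty finite path that starts in `s`, ends in a state of `F`, and visits `F` only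
at its last position. -/
def IsProperPath (s : S) (F : Set S) (π : List S) : Prop :=
  π.head? = some s ∧ (∃ f ∈ F, π.getLast? = some f) ∧ ∀ x ∈ π.dropLast, x ∉ F

/-- The `k`-th termination moment: the sum over all proper paths `π` from `s` to `F` of the weight
of `π` times the `k`-th power of its number of steps (with `0 ^ 0 = 1`). -/
def terminationMoment (M : S → S → ℝ≥0∞) (k : ℕ) (s : S) (F : Set S) : ℝ≥0∞ :=
  ∑' π : {π : List S // IsProperPath s F π},
    pathWeight M π.1 * (((π.1.length - 1 : ℕ) : ℝ≥0∞) ^ k)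

end Systems

/-! ### Weighted and probabilistic pushdown automata -/

/-- A transition: in control state `src` with `top` on top of the stack, replace `top` by the word
`push` (whose first letter becomes the new top) and move to `tgt`, with the given rational
weight. -/
structure PDATransition (Q Γ : Type) where
  src : Q
  top : Γ
  weight : ℚ≥0
  tgt : Q
  push : List Γ

/-- Weighted pushdown automata with (finite) state set `Q` and (finite) stack alphabet `Γ`: a finite
set of weighted transitions, each of which pushes at most two symbols. -/
structure WeightedPDA (Q Γ : Type) where
  trans : Finset (PDATransition Q Γ)
  push_length : ∀ t ∈ trans, t.push.length ≤ 2

namespace WeightedPDA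

variable {Q Γ : Type} (Δ : WeightedPDA Q Γ)

open Classical in
/-- The automaton is probabilistic: for every state `p` and stack symbol `Z` the weights of the
transitions that leave `pZ` sum up to one. -/
def IsProbabilistic : Prop :=
  ∀ (p : Q) (Z : Γ), ∑ t ∈ Δ.trans with t.src = p ∧ t.top = Z, t.weight = 1

open Classical in
/-- The transition matrix on configurations (a control state and the stack content, top of the
stack first): the entry at `(pZβ, qαβ)` is the total weight of the transitions from `pZ` to `qα`.
Rows of configurations with an empty stack are zero. -/
def step : Q × List Γ → Q × List Γ → ℝ≥0∞
  | (_, []), _ => 0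
  | (p, Z :: β), d =>
      ∑ t ∈ Δ.trans with t.src = p ∧ t.top = Z ∧ (t.tgt, t.push ++ β) = d,
        ((t.weight : ℝ≥0) : ℝ≥0∞)

/-- The configurations with an empty stack. -/
def emptyStack (Q Γ : Type) : Set (Q × List Γ) := {c | c.2 = []}

/-- The expected runtime until the stack is empty, from an arbitrary configuration. -/
def ertConfig (c : Q × List Γ) : ℝ≥0∞ := expectedRuntime Δ.step (emptyStack Q Γ) c

/-- The expected runtime from the initial configuration `pZ`. -/
def ert (p : Q) (Z : Γ) : ℝ≥0∞ := Δ.ertConfig (p, [Z])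

/-- The `k`-th termination moment from `pZ` to the configuration `q` with empty stack. -/
def moment (k : ℕ) (p : Q) (Z : Γ) (q : Q) : ℝ≥0∞ :=
  terminationMoment Δ.step k (p, [Z]) {(q, [])}

/-- The return probability `[pZq]`: the zeroth termination moment. -/
def returnProb (p : Q) (Z : Γ) (q : Q) : ℝ≥0∞ := Δ.moment 0 p Z q

/-- The first termination moment from `pZ` to `q`. -/
def firstMoment (p : Q) (Z : Γ) (q : Q) : ℝ≥0∞ := Δ.moment 1 p Z q

/-- Positive almost-sure termination: from every configuration the expected runtime is finite. -/
def IsPAST : Prop := ∀ c : Q × List Γ, Δ.ertConfig c < ∞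

/-- The minimal nonzero return probability of the automaton. -/
def minReturnProb : ℝ≥0∞ :=
  sInf {x | x ≠ 0 ∧ ∃ (p : Q) (Z : Γ) (q : Q), Δ.returnProb p Z q = x}

/-- The encoding size: the number of states, plus the number of stack symbols, plus the length of
the list of all transitions, where each occurrence of a state or of a stack symbol has length one
and the weight is written as a pair of integers in binary. -/
def encodingSize [Fintype Q] [Fintype Γ] : ℕ :=
  Fintype.card Q + Fintype.card Γ +
    ∑ t ∈ Δ.trans, (3 + t.push.length + t.weight.num.size + t.weight.den.size)

end WeightedPDA

end

/-!
The automaton computes in its control state the parity of `2 ^ n` bits, each of which is `1` with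
probability `1/4`; squaring the distribution `n` times makes the difference between the
probabilities of even and odd parity exactly `(1/2) ^ (2 ^ n)`. A generator symbol is replaced by
two generators with the probability `P` of odd parity, so `2 * P + (1/2) ^ (2 ^ n) = 1` and the
branching process of generators is subcritical, but only by a doubly exponentially small margin.

Expected runtimes are the least solution of a linear system. An explicit solution of this system
shows that they are finite. In the other direction, two stacked generators take at least twice the
time `R` of one generator, which gives `1 + 2 * P * R ≤ R`, that is, `2 ^ (2 ^ n) ≤ R`. The return
probabilities are least solutions as well, hence bounded above by any explicit solution, and the
bounds are attained because both they and the return probabilities sum to one.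
-/

section SequenceSums

theorem eq_tsum_of_eq_add_succ {e h : ℕ → ℝ≥0∞} (hstep : ∀ k, e k = h k + e (k + 1))
    (hlim : Filter.Tendsto e Filter.atTop (nhds 0)) : e 0 = ∑' k, h k := by
  have htelescope : ∀ K, ∑ k ∈ Finset.range K, h k + e K = e 0 := fun K => by
    induction K with
    | zero => simp
    | succ K ih => rw [Finset.sum_range_succ, add_assoc, ← hstep, ih]
  have hsum := (ENNReal.tendsto_nat_tsum h).add hlim
  simp only [htelescope, add_zero] at hsum
  exact tendsto_nhds_unique tendsto_const_nhds hsum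

theorem tsum_tsum_add_add_one (f : ℕ → ℝ≥0∞) : ∑' k, ∑' i, f (k + i + 1) = ∑' j, f j * j := by
  let e := Finset.HasAntidiagonal.sigmaAntidiagonalEquivProd (A := ℕ)
  have hfiber (n : ℕ) (x : Finset.HasAntidiagonal.antidiagonal n) :
      (e ⟨n, x⟩).1 + (e ⟨n, x⟩).2 = n :=
    Finset.HasAntidiagonal.mem_antidiagonal.1 x.2
  calc ∑' k, ∑' i, f (k + i + 1) = ∑' x, f ((e x).1 + (e x).2 + 1) := by
        rw [← ENNReal.tsum_prod, ← e.tsum_eq]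
    _ = ∑' n, f (n + 1) * (n + 1 : ℕ) := by
        rw [ENNReal.tsum_sigma']
        simp [hfiber, mul_comm]
    _ = ∑' j, f j * j := by
        rw [tsum_eq_zero_add' (f := fun j : ℕ => f j * j) ENNReal.summable]
        simp

end SequenceSums

section LinearSystems

variable {S : Type}

theorem matVec_mono (A : S → S → ℝ≥0∞) : Monotone (matVec A) :=
  fun _ _ h _ => ENNReal.tsum_le_tsum fun t => mul_le_mul_right (h t) _

theorem matVec_add (A : S → S → ℝ≥0∞) (u v : S → ℝ≥0∞) :
    matVec A (u + v) = matVec A u + matVec A v := by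
  ext s
  simp only [matVec, Pi.add_apply, mul_add, ENNReal.tsum_add]

theorem matVec_tsum_mul {ι : Type*} (A : S → S → ℝ≥0∞) (u : ι → S → ℝ≥0∞) (c : ι → ℝ≥0∞) :
    matVec A (fun t => ∑' i, u i t * c i) = fun s => ∑' i, matVec A (u i) s * c i := by
  ext s
  simp only [matVec, ← ENNReal.tsum_mul_left, ← ENNReal.tsum_mul_right, ← mul_assoc]
  exact ENNReal.tsum_comm

theorem iterate_matVec_add (A : S → S → ℝ≥0∞) (k : ℕ) (u v : S → ℝ≥0∞) :
    (matVec A)^[k] (u + v) = (matVec A)^[k] u + (matVec A)^[k] v := by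
  induction k with
  | zero => rfl
  | succ k ih => simp only [Function.iterate_succ_apply', ih, matVec_add]

theorem iterate_matVec_tsum_mul {ι : Type*} (A : S → S → ℝ≥0∞) (k : ℕ) (u : ι → S → ℝ≥0∞)
    (c : ι → ℝ≥0∞) :
    (matVec A)^[k] (fun t => ∑' i, u i t * c i) = fun s => ∑' i, (matVec A)^[k] (u i) s * c i := by
  induction k with
  | zero => rfl
  | succ k ih => simp only [Function.iterate_succ_apply', ih, matVec_tsum_mul]

/-- The Neumann series `∑ₖ A ^ k r`, which is the least nonnegative solution `v` of the linear
system `v = r + A v`. Expected runtimes and hitting probabilities are both of this form. -/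
noncomputable def neumannSeries (A : S → S → ℝ≥0∞) (r : S → ℝ≥0∞) (s : S) : ℝ≥0∞ :=
  ∑' k : ℕ, (matVec A)^[k] r s

theorem neumannSeries_eq_add_matVec (A : S → S → ℝ≥0∞) (r : S → ℝ≥0∞) :
    neumannSeries A r = r + matVec A (neumannSeries A r) := by
  have htail : matVec A (neumannSeries A r) = fun s => ∑' k : ℕ, (matVec A)^[k + 1] r s := by
    unfold neumannSeries
    simpa only [Function.iterate_succ_apply', Pi.one_apply, mul_one] using
      matVec_tsum_mul A (fun k => (matVec A)^[k] r) 1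
  rw [htail]
  ext s
  exact tsum_eq_zero_add' ENNReal.summable

theorem neumannSeries_le {A : S → S → ℝ≥0∞} {r g : S → ℝ≥0∞} (h : r + matVec A g ≤ g) :
    neumannSeries A r ≤ g := by
  have hpartial : ∀ K, (fun s => ∑ k ∈ Finset.range K, (matVec A)^[k] r s) + (matVec A)^[K] g
      ≤ g := fun K => by
    induction K with
    | zero => intro s; simp
    | succ K ih =>
      refine le_trans (fun s => ?_) ih
      have hK := (matVec_mono A).iterate K h s
      rw [iterate_matVec_add] at hK
      simp only [Pi.add_apply, Finset.sum_range_succ, Function.iterate_succ_apply, add_assoc]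
      gcongr
      exact hK
  intro s
  rw [neumannSeries, ENNReal.tsum_eq_iSup_nat]
  exact iSup_le fun K => le_self_add.trans (hpartial K s)

theorem neumannSeries_add (A : S → S → ℝ≥0∞) (r r' : S → ℝ≥0∞) :
    neumannSeries A (r + r') = neumannSeries A r + neumannSeries A r' := by
  ext s
  simp only [neumannSeries, iterate_matVec_add, Pi.add_apply, ENNReal.tsum_add]

theorem neumannSeries_tsum_mul {ι : Type*} (A : S → S → ℝ≥0∞) (r : ι → S → ℝ≥0∞) (c : ι → ℝ≥0∞) :
    neumannSeries A (fun t => ∑' i, r i t * c i)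
      = fun s => ∑' i, neumannSeries A (r i) s * c i := by
  ext s
  simp only [neumannSeries, iterate_matVec_tsum_mul, ← ENNReal.tsum_mul_right]
  exact ENNReal.tsum_comm

end LinearSystems

section HittingTimes

variable {S : Type} {M : S → S → ℝ≥0∞} {F : Set S}

theorem killRows_eq_self (h : ∀ s ∈ F, ∀ t, M s t = 0) : killRows M F = M := by
  ext s t
  by_cases hs : s ∈ F <;> simp [killRows, hs, h]

theorem matVec_killRows_of_mem {s : S} (hs : s ∈ F) (v : S → ℝ≥0∞) :
    matVec (killRows M F) v s = 0 := by
  simp [matVec, killRows, hs]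

theorem matVec_killRows_of_notMem {s : S} (hs : s ∉ F) (v : S → ℝ≥0∞) :
    matVec (killRows M F) v s = matVec M v s := by
  simp [matVec, killRows, hs]

theorem indicator_one_add_offTarget (F : Set S) : F.indicator 1 + offTarget F = 1 := by
  ext s
  by_cases hs : s ∈ F <;> simp [offTarget, hs]

/-- The total weight of the proper paths from a state to `F` with exactly `k` steps. -/
noncomputable def hitWeight (M : S → S → ℝ≥0∞) (F : Set S) (k : ℕ) : S → ℝ≥0∞ :=
  (matVec (killRows M F))^[k] (F.indicator 1)

theorem hitWeight_succ (M : S → S → ℝ≥0∞) (F : Set S) (k : ℕ) :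
    hitWeight M F (k + 1) = matVec (killRows M F) (hitWeight M F k) :=
  Function.iterate_succ_apply' _ _ _

theorem isProperPath_cons_cons {s t : S} {π : List S} :
    IsProperPath s F (s :: t :: π) ↔ s ∉ F ∧ IsProperPath t F (t :: π) := by
  simp only [IsProperPath, List.head?_cons, List.getLast?_cons_cons, List.dropLast_cons_cons,
    List.forall_mem_cons, true_and]
  tauto

open Classical in
theorem tsum_pathWeight_of_length_eq (M : S → S → ℝ≥0∞) (F : Set S) (k : ℕ) (s : S) :
    ∑' π : List S, (if IsProperPath s F (s :: π) ∧ π.length = k then pathWeight M (s :: π) else 0)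
      = hitWeight M F k s := by
  induction k generalizing s with
  | zero =>
    rw [tsum_eq_single [] fun π hπ => by simp [hπ]]
    simp [IsProperPath, pathWeight, hitWeight, Set.indicator_apply]
  | succ k ih =>
    have hcons : Function.Injective fun x : S × List S => x.1 :: x.2 := fun x y h =>
      Prod.ext (List.cons.inj h).1 (List.cons.inj h).2
    rw [hitWeight_succ, ← hcons.tsum_eq, ENNReal.tsum_prod']
    · by_cases hs : s ∈ F
      · simp [isProperPath_cons_cons, hs, matVec_killRows_of_mem]
      · rw [matVec_killRows_of_notMem hs]
        simp [isProperPath_cons_cons, hs, matVec, pathWeight, ← ih, ← ENNReal.tsum_mul_left]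
    · rintro (_ | ⟨t, π⟩) hπ
      · simp at hπ
      · exact ⟨(t, π), rfl⟩

theorem terminationMoment_eq_tsum_hitWeight (M : S → S → ℝ≥0∞) (F : Set S) (k : ℕ) (s : S) :
    terminationMoment M k s F = ∑' j : ℕ, hitWeight M F j s * (j : ℝ≥0∞) ^ k := by
  classical
  let w : List S → ℝ≥0∞ := {π | IsProperPath s F π}.indicator
    fun π => pathWeight M π * ((π.length - 1 : ℕ) : ℝ≥0∞) ^ k
  have hhead : Function.support w ⊆ Set.range (s :: ·) := by
    rintro (_ | ⟨t, π⟩) hπ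
    · simp [w, IsProperPath] at hπ
    · have hproper : t :: π ∈ {π | IsProperPath s F π} := Set.mem_of_indicator_ne_zero hπ
      exact ⟨π, by simpa [eq_comm] using hproper.1⟩
  calc terminationMoment M k s F = ∑' π, w (s :: π) :=
        (tsum_subtype _ _).trans ((List.cons_injective).tsum_eq hhead).symm
    _ = ∑' π : List S, ∑' j : ℕ, (if IsProperPath s F (s :: π) ∧ π.length = j then
          pathWeight M (s :: π) else 0) * (j : ℝ≥0∞) ^ k := by
        refine tsum_congr fun π => ?_
        rw [tsum_eq_single π.length fun j hj => by simp [hj.symm]]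
        simp [w, Set.indicator_apply]
    _ = ∑' j : ℕ, hitWeight M F j s * (j : ℝ≥0∞) ^ k := by
        rw [ENNReal.tsum_comm]
        simp only [ENNReal.tsum_mul_right, tsum_pathWeight_of_length_eq]

theorem terminationMoment_zero (M : S → S → ℝ≥0∞) (F : Set S) (s : S) :
    terminationMoment M 0 s F = neumannSeries (killRows M F) (F.indicator 1) s := by
  simp only [terminationMoment_eq_tsum_hitWeight, pow_zero, mul_one]
  rfl

theorem terminationMoment_eq_zero_of_zero {s : S} (h : terminationMoment M 0 s F = 0) (k : ℕ) :
    terminationMoment M k s F = 0 := by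
  simp only [terminationMoment_eq_tsum_hitWeight, pow_zero, mul_one, ENNReal.tsum_eq_zero] at h
  simp [terminationMoment_eq_tsum_hitWeight, h]

theorem terminationMoment_range {ι : Type*} {g : ι → S} (hg : Function.Injective g)
    (hM : ∀ i t, M (g i) t = 0) (k : ℕ) (s : S) :
    terminationMoment M k s (Set.range g) = ∑' i, terminationMoment M k s {g i} := by
  have hindicator : (Set.range g).indicator 1
      = fun t => ∑' i, ({g i} : Set S).indicator (1 : S → ℝ≥0∞) t := by
    ext t
    by_cases ht : t ∈ Set.range g
    · obtain ⟨i, rfl⟩ := ht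
      rw [tsum_eq_single i fun j hj => by simp [hg.ne hj.symm]]
      simp
    · rw [Set.indicator_of_notMem ht, eq_comm, ENNReal.tsum_eq_zero]
      exact fun i => Set.indicator_of_notMem (fun h => ht ⟨i, h.symm⟩) _
  have hrange : killRows M (Set.range g) = M := killRows_eq_self (by simpa using hM)
  have hpoint (i : ι) : killRows M {g i} = M := killRows_eq_self (by simpa using hM i)
  have hsplit (j : ℕ) : hitWeight M (Set.range g) j = fun t => ∑' i, hitWeight M {g i} j t := by
    simpa [hitWeight, hrange, hpoint, hindicator] using
      iterate_matVec_tsum_mul M j (fun i => ({g i} : Set S).indicator 1) 1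
  simp only [terminationMoment_eq_tsum_hitWeight, hsplit, ← ENNReal.tsum_mul_right]
  exact ENNReal.tsum_comm

/-- The total weight of the paths with exactly `k` steps that have not yet reached `F`. -/
noncomputable def survivalWeight (M : S → S → ℝ≥0∞) (F : Set S) (k : ℕ) : S → ℝ≥0∞ :=
  (matVec (killRows M F))^[k] (offTarget F)

theorem hitWeight_add_survivalWeight_zero (M : S → S → ℝ≥0∞) (F : Set S) :
    hitWeight M F 0 + survivalWeight M F 0 = 1 :=
  indicator_one_add_offTarget F

theorem survivalWeight_eq_add_succ (hM : ∀ s ∉ F, ∑' t, M s t = 1) (k : ℕ) :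
    survivalWeight M F k = hitWeight M F (k + 1) + survivalWeight M F (k + 1) := by
  have hstochastic : matVec (killRows M F) 1 = offTarget F := by
    ext s
    by_cases hs : s ∈ F <;> simp [matVec, killRows, offTarget, hs, hM]
  rw [hitWeight, survivalWeight, survivalWeight, ← iterate_matVec_add, indicator_one_add_offTarget,
    Function.iterate_succ_apply, hstochastic]

theorem survivalWeight_eq_tsum_hitWeight (hM : ∀ s ∉ F, ∑' t, M s t = 1) {s : S}
    (hfin : expectedRuntime M F s ≠ ∞) (k : ℕ) :
    survivalWeight M F k s = ∑' i, hitWeight M F (k + i + 1) s :=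
  eq_tsum_of_eq_add_succ (e := fun i => survivalWeight M F (k + i) s)
    (fun i => congrFun (survivalWeight_eq_add_succ hM (k + i)) s)
    ((ENNReal.tendsto_atTop_zero_of_tsum_ne_top hfin).comp
      (Filter.tendsto_atTop_mono (fun i => Nat.le_add_left i k) Filter.tendsto_id))

theorem terminationMoment_zero_eq_one (hM : ∀ s ∉ F, ∑' t, M s t = 1) {s : S}
    (hfin : expectedRuntime M F s ≠ ∞) : terminationMoment M 0 s F = 1 := by
  simp only [terminationMoment_eq_tsum_hitWeight, pow_zero, mul_one]
  calc ∑' j, hitWeight M F j s = hitWeight M F 0 s + ∑' i, hitWeight M F (0 + i + 1) s := by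
        simp only [zero_add]
        exact tsum_eq_zero_add' ENNReal.summable
    _ = 1 := by
        rw [← survivalWeight_eq_tsum_hitWeight hM hfin]
        exact congrFun (hitWeight_add_survivalWeight_zero M F) s

theorem terminationMoment_one_eq_expectedRuntime (hM : ∀ s ∉ F, ∑' t, M s t = 1) {s : S}
    (hfin : expectedRuntime M F s ≠ ∞) : terminationMoment M 1 s F = expectedRuntime M F s :=
  calc terminationMoment M 1 s F = ∑' j : ℕ, hitWeight M F j s * j := by
        simp only [terminationMoment_eq_tsum_hitWeight, pow_one]
    _ = ∑' k, ∑' i, hitWeight M F (k + i + 1) s :=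
        (tsum_tsum_add_add_one fun j => hitWeight M F j s).symm
    _ = expectedRuntime M F s :=
        tsum_congr fun k => (survivalWeight_eq_tsum_hitWeight hM hfin k).symm

end HittingTimes

namespace WeightedPDA

section Configurations

variable {Q Γ : Type} (Δ : WeightedPDA Q Γ)

open Classical in
theorem matVec_step_cons (v : Q × List Γ → ℝ≥0∞) (p : Q) (Z : Γ) (β : List Γ) :
    matVec Δ.step v (p, Z :: β) = ∑ t ∈ Δ.trans with t.src = p ∧ t.top = Z,
      ((t.weight : ℝ≥0) : ℝ≥0∞) * v (t.tgt, t.push ++ β) := by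
  have hentry : ∀ d, Δ.step (p, Z :: β) d * v d = ∑ t ∈ Δ.trans with t.src = p ∧ t.top = Z,
      if d = (t.tgt, t.push ++ β) then ((t.weight : ℝ≥0) : ℝ≥0∞) * v d else 0 := fun d => by
    simp only [step, Finset.sum_mul, ← and_assoc, eq_comm (a := d)]
    rw [← Finset.filter_filter, Finset.sum_filter]
  simp only [matVec, hentry]
  rw [Summable.tsum_finsetSum fun _ _ => ENNReal.summable]
  exact Finset.sum_congr rfl fun t _ => tsum_ite_eq _ _

theorem matVec_step_append (v : Q × List Γ → ℝ≥0∞) (p : Q) (Z : Γ) (α β : List Γ) :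
    matVec Δ.step (fun c => v (c.1, c.2 ++ β)) (p, Z :: α)
      = matVec Δ.step v (p, Z :: α ++ β) := by
  simp only [List.cons_append, matVec_step_cons, List.append_assoc]

variable {Δ} in
theorem IsProbabilistic.tsum_step_eq_one (hΔ : Δ.IsProbabilistic) :
    ∀ c ∉ emptyStack Q Γ, ∑' d, Δ.step c d = 1 := by
  rintro ⟨p, _ | ⟨Z, β⟩⟩ hc
  · exact absurd rfl hc
  · have hrow := Δ.matVec_step_cons 1 p Z β
    simp only [matVec, Pi.one_apply, mul_one] at hrow
    rw [hrow]
    exact_mod_cast congrArg (fun x : ℚ≥0 => ((x : ℝ≥0) : ℝ≥0∞)) (hΔ p Z)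

theorem step_nil (p : Q) (d : Q × List Γ) : Δ.step (p, []) d = 0 := by
  simp only [step]

theorem matVec_step_nil (v : Q × List Γ → ℝ≥0∞) (p : Q) : matVec Δ.step v (p, []) = 0 := by
  simp [matVec, step_nil]

theorem killRows_step {F : Set (Q × List Γ)} (hF : F ⊆ emptyStack Q Γ) :
    killRows Δ.step F = Δ.step := by
  refine killRows_eq_self ?_
  rintro ⟨p, _ | ⟨Z, β⟩⟩ hc d
  · exact Δ.step_nil p d
  · simpa [emptyStack] using hF hc

theorem ertConfig_eq_neumannSeries :
    Δ.ertConfig = neumannSeries Δ.step (offTarget (emptyStack Q Γ)) := by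
  ext c
  rw [ertConfig, expectedRuntime, killRows_step _ subset_rfl, neumannSeries]

theorem ertConfig_cons (p : Q) (Z : Γ) (β : List Γ) :
    Δ.ertConfig (p, Z :: β) = 1 + matVec Δ.step Δ.ertConfig (p, Z :: β) := by
  conv_lhs => rw [ertConfig_eq_neumannSeries, neumannSeries_eq_add_matVec]
  simp [ertConfig_eq_neumannSeries, offTarget, emptyStack]

theorem ertConfig_le {g : Q × List Γ → ℝ≥0∞}
    (hg : ∀ p Z β, 1 + matVec Δ.step g (p, Z :: β) ≤ g (p, Z :: β)) : Δ.ertConfig ≤ g := by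
  rw [ertConfig_eq_neumannSeries]
  refine neumannSeries_le ?_
  rintro ⟨p, _ | ⟨Z, β⟩⟩
  · simp [matVec_step_nil, offTarget, emptyStack]
  · simpa [offTarget, emptyStack] using hg p Z β

/-- The return probability `[pαq]` for an arbitrary initial stack content `α`: the probability of
reaching `q` with empty stack from the configuration `pα`. -/
noncomputable def returnProbConfig (c : Q × List Γ) (q : Q) : ℝ≥0∞ :=
  terminationMoment Δ.step 0 c {(q, [])}

theorem returnProbConfig_eq_neumannSeries (c : Q × List Γ) (q : Q) :
    Δ.returnProbConfig c q = neumannSeries Δ.step (({(q, [])} : Set _).indicator 1) c := by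
  rw [returnProbConfig, terminationMoment_zero, killRows_step _ (by simp [emptyStack])]

theorem returnProbConfig_le {q : Q} {g : Q × List Γ → ℝ≥0∞} (hnil : 1 ≤ g (q, []))
    (hcons : ∀ p Z β, matVec Δ.step g (p, Z :: β) ≤ g (p, Z :: β)) (c : Q × List Γ) :
    Δ.returnProbConfig c q ≤ g c := by
  rw [returnProbConfig_eq_neumannSeries]
  refine neumannSeries_le ?_ c
  rintro ⟨p, _ | ⟨Z, β⟩⟩
  · by_cases hpq : p = q <;> simp [matVec_step_nil, hpq, hnil]
  · simpa using hcons p Z β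

-- The left-hand side is the least solution of the linear system that `pα ↦ ert(pαβ)` solves.
theorem ertConfig_add_tsum_le_ertConfig_append (p : Q) (α β : List Γ) :
    Δ.ertConfig (p, α) + ∑' q, Δ.returnProbConfig (p, α) q * Δ.ertConfig (q, β)
      ≤ Δ.ertConfig (p, α ++ β) := by
  have hleast : neumannSeries Δ.step (offTarget (emptyStack Q Γ) + fun c => ∑' q,
        ({(q, [])} : Set (Q × List Γ)).indicator 1 c * Δ.ertConfig (q, β))
      ≤ fun c => Δ.ertConfig (c.1, c.2 ++ β) := by
    refine neumannSeries_le ?_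
    rintro ⟨p, _ | ⟨Z, α⟩⟩
    · have hself : ∑' q, ({(q, [])} : Set (Q × List Γ)).indicator 1 (p, []) * Δ.ertConfig (q, β)
          = Δ.ertConfig (p, β) := by
        rw [tsum_eq_single p fun q hq => by simp [hq.symm]]
        simp
      simp [matVec_step_nil, offTarget, emptyStack, hself]
    · simp [matVec_step_append, ertConfig_cons, offTarget, emptyStack]
  rw [neumannSeries_add, neumannSeries_tsum_mul] at hleast
  simpa only [Pi.add_apply, returnProbConfig_eq_neumannSeries, ertConfig_eq_neumannSeries] using
    hleast (p, α)

theorem terminationMoment_emptyStack (k : ℕ) (c : Q × List Γ) :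
    terminationMoment Δ.step k c (emptyStack Q Γ)
      = ∑' q, terminationMoment Δ.step k c {(q, [])} := by
  have hrange : emptyStack Q Γ = Set.range fun q : Q => (q, ([] : List Γ)) := by
    ext ⟨p, α⟩
    simp [emptyStack, eq_comm]
  rw [hrange, terminationMoment_range (Prod.mk_left_injective []) Δ.step_nil]

variable {Δ}

theorem IsProbabilistic.tsum_returnProbConfig (hΔ : Δ.IsProbabilistic) {c : Q × List Γ}
    (hfin : Δ.ertConfig c ≠ ∞) : ∑' q, Δ.returnProbConfig c q = 1 :=
  (Δ.terminationMoment_emptyStack 0 c).symm.trans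
    (terminationMoment_zero_eq_one hΔ.tsum_step_eq_one hfin)

theorem IsProbabilistic.ert_eq_tsum_firstMoment (hΔ : Δ.IsProbabilistic) {p : Q} {Z : Γ}
    (hfin : Δ.ert p Z ≠ ∞) : Δ.ert p Z = ∑' q, Δ.firstMoment p Z q :=
  (terminationMoment_one_eq_expectedRuntime hΔ.tsum_step_eq_one hfin).symm.trans
    (Δ.terminationMoment_emptyStack 1 (p, [Z]))

theorem firstMoment_eq_zero {p q : Q} {Z : Γ} (h : Δ.returnProb p Z q = 0) :
    Δ.firstMoment p Z q = 0 :=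
  terminationMoment_eq_zero_of_zero h 1

theorem IsProbabilistic.returnProbConfig_eq_of_le (hΔ : Δ.IsProbabilistic) {c : Q × List Γ}
    (hfin : Δ.ertConfig c ≠ ∞) {u : Q → ℝ≥0∞} (hle : ∀ q, Δ.returnProbConfig c q ≤ u q)
    (hu : ∑' q, u q = 1) (q : Q) : Δ.returnProbConfig c q = u q := by
  have hsum := hΔ.tsum_returnProbConfig hfin
  refine (hle q).eq_of_not_lt fun hlt => ?_
  have hlt_tsum := ENNReal.tsum_lt_tsum (hsum ▸ ENNReal.one_ne_top) hle hlt
  rw [hsum, hu] at hlt_tsum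
  exact hlt_tsum.false

end Configurations

section OfRules

variable {Q Γ : Type} [Fintype Q] [Fintype Γ]

/-- The automaton with a transition from `pZ` to `qα` of weight `w` for each `(w, q, α)` in
`rules p Z`. -/
def ofRules (rules : Q → Γ → Finset (ℚ≥0 × Q × List Γ))
    (hrules : ∀ p Z, ∀ x ∈ rules p Z, x.2.2.length ≤ 2) : WeightedPDA Q Γ where
  trans := (Finset.univ.sigma fun y : Q × Γ => rules y.1 y.2).map
    ⟨fun x => ⟨x.1.1, x.1.2, x.2.1, x.2.2.1, x.2.2.2⟩, by
      rintro ⟨⟨p, Z⟩, w, q, α⟩ ⟨⟨p', Z'⟩, w', q', α'⟩ h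
      simp_all⟩
  push_length := by
    intro t ht
    obtain ⟨x, hx, rfl⟩ := Finset.mem_map.1 ht
    exact hrules _ _ _ (Finset.mem_sigma.1 hx).2

variable {rules : Q → Γ → Finset (ℚ≥0 × Q × List Γ)}
  {hrules : ∀ p Z, ∀ x ∈ rules p Z, x.2.2.length ≤ 2}

theorem sum_trans_ofRules {M : Type*} [AddCommMonoid M] (f : PDATransition Q Γ → M) :
    ∑ t ∈ (ofRules rules hrules).trans, f t
      = ∑ p, ∑ Z, ∑ x ∈ rules p Z, f ⟨p, Z, x.1, x.2.1, x.2.2⟩ := by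
  rw [ofRules, Finset.sum_map, Finset.sum_sigma, Fintype.sum_prod_type]
  rfl

open Classical in
theorem sum_trans_filter_ofRules {M : Type*} [AddCommMonoid M] (f : PDATransition Q Γ → M)
    (p : Q) (Z : Γ) :
    ∑ t ∈ (ofRules rules hrules).trans with t.src = p ∧ t.top = Z, f t
      = ∑ x ∈ rules p Z, f ⟨p, Z, x.1, x.2.1, x.2.2⟩ := by
  rw [Finset.sum_filter, sum_trans_ofRules, Fintype.sum_eq_single p, Fintype.sum_eq_single Z]
  · simp
  · intro Z' hZ
    simp [hZ]
  · intro p' hp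
    simp [hp]

theorem isProbabilistic_ofRules (h : ∀ p Z, ∑ x ∈ rules p Z, x.1 = 1) :
    (ofRules rules hrules).IsProbabilistic :=
  fun p Z => (sum_trans_filter_ofRules _ p Z).trans (h p Z)

theorem matVec_step_ofRules (v : Q × List Γ → ℝ≥0∞) (p : Q) (Z : Γ) (β : List Γ) :
    matVec (ofRules rules hrules).step v (p, Z :: β)
      = ∑ x ∈ rules p Z, ((x.1 : ℝ≥0) : ℝ≥0∞) * v (x.2.1, x.2.2 ++ β) :=
  (matVec_step_cons _ v p Z β).trans (sum_trans_filter_ofRules _ p Z)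

end OfRules

end WeightedPDA

section Parity

/-- The distribution of the parity (`true` is odd) of `2 ^ i` independent random bits, each of
which is `1` with probability `1 / 4`. -/
noncomputable def parityProb : ℕ → Bool → ℝ≥0
  | 0, false => 3 / 4
  | 0, true => 1 / 4
  | i + 1, false => parityProb i false ^ 2 + parityProb i true ^ 2
  | i + 1, true => 2 * parityProb i false * parityProb i true

theorem parityProb_false_add_true (i : ℕ) : parityProb i false + parityProb i true = 1 := by
  induction i with
  | zero =>
    rw [parityProb, parityProb, ← add_div]
    norm_num
  | succ i ih =>
    rw [parityProb, parityProb]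
    linear_combination (parityProb i true + parityProb i false + 1) * ih

theorem parityProb_false_eq_add (i : ℕ) :
    parityProb i false = parityProb i true + 2⁻¹ ^ 2 ^ i := by
  induction i with
  | zero =>
    rw [parityProb, parityProb]
    norm_num [← NNReal.coe_inj]
  | succ i ih =>
    rw [parityProb, parityProb, ih]
    ring

theorem two_mul_parityProb_true_add (i : ℕ) : 2 * parityProb i true + 2⁻¹ ^ 2 ^ i = 1 := by
  rw [← parityProb_false_add_true i, parityProb_false_eq_add]
  ring

theorem quarter_le_parityProb (i : ℕ) (b : Bool) : 1 / 4 ≤ parityProb i b := by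
  have hle (i : ℕ) : parityProb i true ≤ parityProb i false :=
    (parityProb_false_eq_add i).symm ▸ le_self_add
  suffices htrue : 1 / 4 ≤ parityProb i true by
    cases b
    · exact htrue.trans (hle i)
    · exact htrue
  induction i with
  | zero => exact le_rfl
  | succ i ih =>
    have hfalse : 1 ≤ 2 * parityProb i false := by
      rw [← parityProb_false_add_true i, two_mul]
      gcongr
      exact hle i
    rw [parityProb]
    exact ih.trans (le_mul_of_one_le_left' hfalse)

end Parity

section ParityPDA

variable {n : ℕ}

/-- The stack symbols of `parityPDA n`. -/
inductive ParitySymbol (n : ℕ) : Type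
  | bit (i : Fin (n + 1))
  | generator
  | test
  deriving DecidableEq, Fintype

theorem card_paritySymbol (n : ℕ) : Fintype.card (ParitySymbol n) = n + 3 := by
  rw [← Fintype.card_congr (proxy_equiv% (ParitySymbol n))]
  simp

open ParitySymbol

/-- The weights and right-hand sides of the transitions of `parityPDA n`. -/
def parityRules (n : ℕ) : Bool → ParitySymbol n → Finset (ℚ≥0 × Bool × List (ParitySymbol n))
  | s, bit ⟨0, _⟩ => {(3 / 4, s, []), (1 / 4, !s, [])}
  | s, bit ⟨i + 1, h⟩ => {(1, s, [bit ⟨i, by omega⟩, bit ⟨i, by omega⟩])}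
  | _, generator => {(1, false, [bit (Fin.last n), test])}
  | false, test => {(1, false, [])}
  | true, test => {(1, false, [generator, generator])}

theorem length_le_of_mem_parityRules :
    ∀ s Z, ∀ x ∈ parityRules n s Z, x.2.2.length ≤ 2 := by
  rintro (_ | _) (⟨_ | i, h⟩ | _ | _) <;> simp [parityRules]

/-- An automaton whose control state is a parity. The symbol `bit i` adds the parity of `2 ^ i`
random bits to the control state; `generator` resets the control state, pushes `bit n`, and has
`test` replaced by two further generators if the resulting parity is odd. -/
def parityPDA (n : ℕ) : WeightedPDA Bool (ParitySymbol n) :=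
  .ofRules (parityRules n) length_le_of_mem_parityRules

theorem isProbabilistic_parityPDA (n : ℕ) : (parityPDA n).IsProbabilistic := by
  have hweights : (3 / 4 + 1 / 4 : ℚ≥0) = 1 := by rw [← add_div]; norm_num
  refine WeightedPDA.isProbabilistic_ofRules ?_
  rintro s (⟨_ | i, h⟩ | _ | _)
  · rw [parityRules, Finset.sum_pair (by simp), hweights]
  · exact Finset.sum_singleton _ _
  · exact Finset.sum_singleton _ _
  · cases s <;> exact Finset.sum_singleton _ _

section Transitions

variable (v : Bool × List (ParitySymbol n) → ℝ≥0∞) (s : Bool) (β : List (ParitySymbol n))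

theorem matVec_step_bit_zero (h : 0 < n + 1) :
    matVec (parityPDA n).step v (s, bit ⟨0, h⟩ :: β)
      = parityProb 0 false * v (s, β) + parityProb 0 true * v (!s, β) := by
  rw [parityPDA, WeightedPDA.matVec_step_ofRules, parityRules, Finset.sum_pair (by simp)]
  simp [parityProb]

theorem matVec_step_bit_succ {i : ℕ} (h : i + 1 < n + 1) :
    matVec (parityPDA n).step v (s, bit ⟨i + 1, h⟩ :: β)
      = v (s, bit ⟨i, by omega⟩ :: bit ⟨i, by omega⟩ :: β) := by
  simp [parityPDA, WeightedPDA.matVec_step_ofRules, parityRules]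

theorem matVec_step_generator :
    matVec (parityPDA n).step v (s, generator :: β) = v (false, bit (Fin.last n) :: test :: β) := by
  simp [parityPDA, WeightedPDA.matVec_step_ofRules, parityRules]

theorem matVec_step_test_false :
    matVec (parityPDA n).step v (false, test :: β) = v (false, β) := by
  simp [parityPDA, WeightedPDA.matVec_step_ofRules, parityRules]

theorem matVec_step_test_true :
    matVec (parityPDA n).step v (true, test :: β) = v (false, generator :: generator :: β) := by
  simp [parityPDA, WeightedPDA.matVec_step_ofRules, parityRules]

end Transitions

/-- The number of steps in which the automaton removes the symbol `bit i`. -/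
def bitSteps : ℕ → ℕ
  | 0 => 1
  | i + 1 => 1 + 2 * bitSteps i

/-- The expected number of steps in which `parityPDA n` removes the symbol `generator`, namely the
solution of the equation `generatorSteps_eq`. -/
def generatorSteps (n : ℕ) : ℕ := (bitSteps n + 2) * 2 ^ 2 ^ n

theorem generatorSteps_eq (n : ℕ) :
    (generatorSteps n : ℝ≥0) = bitSteps n + 2 + 2 * parityProb n true * generatorSteps n := by
  have hpow : (2⁻¹ : ℝ≥0) ^ 2 ^ n * 2 ^ 2 ^ n = 1 := by
    rw [← mul_pow, inv_mul_cancel₀ two_ne_zero, one_pow]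
  calc (generatorSteps n : ℝ≥0)
      = (2 * parityProb n true + 2⁻¹ ^ 2 ^ n) * generatorSteps n := by
        rw [two_mul_parityProb_true_add, one_mul]
    _ = 2⁻¹ ^ 2 ^ n * 2 ^ 2 ^ n * (bitSteps n + 2) + 2 * parityProb n true * generatorSteps n := by
        push_cast [generatorSteps]
        ring
    _ = _ := by rw [hpow, one_mul]

/-- The expected total cost of emptying the stack when each step costs `κ` and ending in the state
`s` costs another `h s`; with `κ = 0` and `h` the indicator of a state this is a return
probability. -/
noncomputable def parityValue (κ : ℝ≥0) (h : Bool → ℝ≥0) : List (ParitySymbol n) → Bool → ℝ≥0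
  | [], s => h s
  | bit i :: β, s => bitSteps i * κ +
      (parityProb i false * parityValue κ h β s + parityProb i true * parityValue κ h β !s)
  | generator :: β, _ => generatorSteps n * κ + parityValue κ h β false
  | test :: β, false => κ + parityValue κ h β false
  | test :: β, true => (1 + 2 * generatorSteps n) * κ + parityValue κ h β false

theorem add_matVec_parityValue (κ : ℝ≥0) (h : Bool → ℝ≥0) (s : Bool) (Z : ParitySymbol n)
    (β : List (ParitySymbol n)) :
    κ + matVec (parityPDA n).step (fun c => (parityValue κ h c.2 c.1 : ℝ≥0∞)) (s, Z :: β)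
      = parityValue κ h (Z :: β) s := by
  rcases Z with ⟨_ | i, hi⟩ | _ | _
  · rw [matVec_step_bit_zero, parityValue]
    simp [bitSteps]
  · have hsum := parityProb_false_add_true i
    rw [matVec_step_bit_succ]
    norm_cast
    simp only [parityValue, bitSteps, parityProb, Bool.not_not]
    push_cast
    linear_combination (bitSteps i * κ) * hsum
  · have hsum := parityProb_false_add_true n
    have hgen := generatorSteps_eq n
    rw [matVec_step_generator]
    norm_cast
    simp only [parityValue, Fin.val_last, Bool.not_false]
    linear_combination (κ + parityValue κ h β false) * hsum + κ * hgen.symm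
  · cases s
    · rw [matVec_step_test_false, parityValue]
      norm_cast
    · rw [matVec_step_test_true]
      norm_cast
      simp only [parityValue]
      ring

theorem isPAST_parityPDA (n : ℕ) : (parityPDA n).IsPAST := fun c =>
  ((parityPDA n).ertConfig_le (fun p Z β => (add_matVec_parityValue 1 0 p Z β).le) c).trans_lt
    ENNReal.coe_lt_top

theorem sum_parityValue_single (β : List (ParitySymbol n)) (s : Bool) :
    ∑ q, parityValue 0 (Pi.single q 1) β s = 1 := by
  induction β generalizing s with
  | nil => cases s <;> simp [parityValue]
  | cons Z β ih =>
    rcases Z with i | _ | _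
    · simp only [parityValue, mul_zero, zero_add, Finset.sum_add_distrib, ← Finset.mul_sum, ih,
        mul_one, parityProb_false_add_true]
    · simpa [parityValue] using ih false
    · cases s <;> simpa [parityValue] using ih false

theorem returnProb_parityPDA (s : Bool) (Z : ParitySymbol n) (q : Bool) :
    (parityPDA n).returnProb s Z q = parityValue 0 (Pi.single q 1) [Z] s := by
  refine (isProbabilistic_parityPDA n).returnProbConfig_eq_of_le (isPAST_parityPDA n _).ne
    (u := fun q => parityValue 0 (Pi.single q 1) [Z] s) (fun q => ?_) ?_ q
  · refine (parityPDA n).returnProbConfig_le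
      (g := fun c => (parityValue 0 (Pi.single q 1) c.2 c.1 : ℝ≥0∞)) ?_ ?_ _
    · simp [parityValue]
    · intro p Z β
      simpa using (add_matVec_parityValue 0 (Pi.single q 1) p Z β).le
  · rw [tsum_fintype]
    exact_mod_cast sum_parityValue_single [Z] s

theorem returnProb_bit (s : Bool) (i : Fin (n + 1)) (q : Bool) :
    (parityPDA n).returnProb s (bit i) q = parityProb i (s ^^ q) := by
  rw [returnProb_parityPDA]
  cases s <;> cases q <;> simp [parityValue]

theorem returnProb_generator (s q : Bool) :
    (parityPDA n).returnProb s generator q = if q then 0 else 1 := by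
  rw [returnProb_parityPDA]
  cases q <;> simp [parityValue]

theorem returnProb_test (s q : Bool) :
    (parityPDA n).returnProb s test q = if q then 0 else 1 := by
  rw [returnProb_parityPDA]
  cases s <;> cases q <;> simp [parityValue]

theorem quarter_le_minReturnProb_parityPDA (n : ℕ) :
    ((1 / 4 : ℝ≥0) : ℝ≥0∞) ≤ (parityPDA n).minReturnProb := by
  have hquarter : ((1 / 4 : ℝ≥0) : ℝ≥0∞) ≤ 1 := by norm_num
  refine le_sInf ?_
  rintro _ ⟨hne, s, i | _ | _, q, rfl⟩
  · rw [returnProb_bit]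
    exact_mod_cast quarter_le_parityProb i (s ^^ q)
  · rw [returnProb_generator] at hne ⊢
    exact hquarter.trans_eq (if_neg fun hq => hne (if_pos hq)).symm
  · rw [returnProb_test] at hne ⊢
    exact hquarter.trans_eq (if_neg fun hq => hne (if_pos hq)).symm

theorem ert_generator_eq_firstMoment (n : ℕ) :
    (parityPDA n).ert false generator = (parityPDA n).firstMoment false generator false := by
  have hodd : (parityPDA n).firstMoment false generator true = 0 :=
    WeightedPDA.firstMoment_eq_zero (by simp [returnProb_generator])
  rw [(isProbabilistic_parityPDA n).ert_eq_tsum_firstMoment (isPAST_parityPDA n _).ne,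
    tsum_fintype, Fintype.sum_bool, hodd, zero_add]

theorem two_mul_ert_generator_le (n : ℕ) :
    2 * (parityPDA n).ert false generator
      ≤ (parityPDA n).ertConfig (false, [generator, generator]) := by
  have happend :=
    (parityPDA n).ertConfig_add_tsum_le_ertConfig_append false [generator] [generator]
  have hreturn (q : Bool) : (parityPDA n).returnProbConfig (false, [generator]) q
      = if q then 0 else 1 := returnProb_generator false q
  simpa [WeightedPDA.ert, tsum_fintype, hreturn, ← two_mul] using happend

theorem one_add_mul_ert_generator_le (n : ℕ) :
    1 + 2 * parityProb n true * (parityPDA n).ert false generator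
      ≤ (parityPDA n).ert false generator := by
  have hbit : (parityProb n true : ℝ≥0∞) * (parityPDA n).ertConfig (true, [test])
      ≤ (parityPDA n).ertConfig (false, [bit (Fin.last n), test]) := by
    have happend := (parityPDA n).ertConfig_add_tsum_le_ertConfig_append false
      [bit (Fin.last n)] [test]
    have hreturn : (parityPDA n).returnProbConfig (false, [bit (Fin.last n)]) true
      = parityProb n true := returnProb_bit false (Fin.last n) true
    rw [← hreturn]
    exact (ENNReal.le_tsum true).trans (le_add_self.trans happend)
  have htest : 2 * (parityPDA n).ert false generator ≤ (parityPDA n).ertConfig (true, [test]) := by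
    rw [WeightedPDA.ertConfig_cons, matVec_step_test_true]
    exact (two_mul_ert_generator_le n).trans le_add_self
  calc 1 + 2 * parityProb n true * (parityPDA n).ert false generator
      = 1 + parityProb n true * (2 * (parityPDA n).ert false generator) := by ring
    _ ≤ 1 + (parityPDA n).ertConfig (false, [bit (Fin.last n), test]) := by
        gcongr
        exact (mul_le_mul_right htest _).trans hbit
    _ = (parityPDA n).ert false generator := by
        rw [WeightedPDA.ert, WeightedPDA.ertConfig_cons _ _ generator, matVec_step_generator]

theorem two_pow_le_ert_generator (n : ℕ) :
    (2 : ℝ≥0∞) ^ 2 ^ n ≤ (parityPDA n).ert false generator := by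
  have hrec := one_add_mul_ert_generator_le n
  lift (parityPDA n).ert false generator to ℝ≥0 using (isPAST_parityPDA n _).ne with R
  norm_cast at hrec ⊢
  have hbias : 1 ≤ 2⁻¹ ^ 2 ^ n * R := by
    refine le_of_add_le_add_right (a := 2 * parityProb n true * R) (hrec.trans_eq ?_)
    rw [← add_mul, add_comm, two_mul_parityProb_true_add, one_mul]
  rw [inv_pow, inv_mul_eq_div, one_le_div (by positivity)] at hbias
  exact_mod_cast hbias

theorem encodingSize_parityPDA (n : ℕ) :
    (parityPDA n).encodingSize = 2 + (n + 3) + ∑ s, ∑ Z, ∑ x ∈ parityRules n s Z,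
      (3 + x.2.2.length + x.1.num.size + x.1.den.size) := by
  rw [WeightedPDA.encodingSize, parityPDA, WeightedPDA.sum_trans_ofRules, card_paritySymbol,
    Fintype.card_bool]

theorem sum_parityRules_size_le (s : Bool) (Z : ParitySymbol n) :
    ∑ x ∈ parityRules n s Z, (3 + x.2.2.length + x.1.num.size + x.1.den.size) ≤ 15 := by
  rcases Z with ⟨_ | i, h⟩ | _ | _
  · have hthree : (3 / 4 : ℚ≥0).num.size + (3 / 4 : ℚ≥0).den.size = 5 := by decide +kernel
    have hone : (1 / 4 : ℚ≥0).num.size + (1 / 4 : ℚ≥0).den.size = 4 := by decide +kernel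
    rw [parityRules, Finset.sum_pair (by simp)]
    simp only [List.length_nil]
    omega
  · simp [parityRules]
  · simp [parityRules]
  · cases s <;> simp [parityRules]

theorem encodingSize_parityPDA_le (n : ℕ) : (parityPDA n).encodingSize ≤ 31 * n + 95 := by
  have hrows : ∑ s, ∑ Z, ∑ x ∈ parityRules n s Z,
      (3 + x.2.2.length + x.1.num.size + x.1.den.size) ≤ ∑ _s : Bool, ∑ _Z : ParitySymbol n, 15 :=
    Finset.sum_le_sum fun s _ => Finset.sum_le_sum fun Z _ => sum_parityRules_size_le s Z
  simp only [Finset.sum_const, Finset.card_univ, Fintype.card_bool, card_paritySymbol,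
    smul_eq_mul] at hrows
  rw [encodingSize_parityPDA]
  omega

end ParityPDA

theorem theorem10 :
    ∃ (Q Γ : ℕ → Type) (_ : ∀ n, Fintype (Q n)) (_ : ∀ n, Fintype (Γ n))
      (Δ : ∀ n, WeightedPDA (Q n) (Γ n)) (p : ∀ n, Q n) (Y : ∀ n, Γ n),
      (∀ n, 1 ≤ n →
        (Δ n).IsProbabilistic ∧
        (Δ n).IsPAST ∧
        (Δ n).ert (p n) (Y n) = (Δ n).firstMoment (p n) (Y n) (p n) ∧
        (2 : ℝ≥0∞) ^ (2 ^ n) ≤ (Δ n).ert (p n) (Y n)) ∧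
      (∃ c : ℝ≥0, 0 < c ∧ ∀ n, 1 ≤ n → (c : ℝ≥0∞) ≤ (Δ n).minReturnProb) ∧
      (∃ C : ℕ, ∀ n, 1 ≤ n →
        n ≤ C * (Δ n).encodingSize ∧ (Δ n).encodingSize ≤ C * n) := by
  refine ⟨fun _ => Bool, ParitySymbol, fun _ => inferInstance, fun _ => inferInstance, parityPDA,
    fun _ => false, fun _ => .generator, fun n _ => ⟨isProbabilistic_parityPDA n,
      isPAST_parityPDA n, ert_generator_eq_firstMoment n, two_pow_le_ert_generator n⟩,
    ⟨1 / 4, by norm_num, fun n _ => quarter_le_minReturnProb_parityPDA n⟩, 126, fun n hn => ?_⟩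
  have hlower := encodingSize_parityPDA n
  have hupper := encodingSize_parityPDA_le n
  omega
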